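/- Setting. There are $n\ge 2$ experts; expert $i$ has a finite signal space $\mathcal S_i$ with $|\mathcal S_i|=m\ge 1$. Put $\boldsymbol{\mathcal S}=\mathcal S_1\times\dots\times\mathcal S_n$ and let $\mathcal P_{\mathrm{all}}$ be the set of all probability distributions $P$ of $(\boldsymbol s,\omega)$ on $\boldsymbol{\mathcal S}\times\{0,1\}$. Under $P$, expert $i$ with signal $s_i$ reports $r_i=P(\omega=1\mid s_i)$; write $\boldsymbol r=(r_1,\dots,r_n)$. An aggregator is a function $f:[0,1]^n\to[0,1]$, its loss is $L_P(f)=\mathbb E_P[|f(\boldsymbol r)-\omega|^2]$, and $f^*$ denotes an aggregator that minimizes $L_P$ (unique on the reports of positive probability). An aggregator $f$ is $\varepsilon$-optimal for $P$ if $\mathbb E_P[|f(\boldsymbol r)-f^*(\boldsymbol r)|^2]\le\varepsilon$. The sample complexity $T_{\mathcal P_{\mathrm{all}}}(\varepsilon,\delta)$ is the least $T_0$ such that for every $T\ge T_0$ there is a (possibly randomized) procedure which, for every $P\in\mathcal P_{\mathrm{all}}$, given only $T$ samples $(\boldsymbol r^{(t)},\omega^{(t)})$ obtained from i.i.d. draws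 $(\boldsymbol s^{(t)},\omega^{(t)})\sim P$, outputs an $\varepsilon$-optimal aggregator for $P$ with probability at least $1-\delta$ over the samples and its own randomness. Theorem. There are absolute constants $C,c,\varepsilon_0>0$ such that for all $n\ge 2$, all $m\ge1$, all such signal spaces, and all $\varepsilon,\delta\in(0,1)$, $$T_{\mathcal P_{\mathrm{all}}}(\varepsilon,\delta)\ \le\ C\,\frac{m^n+\log(1/\delta)}{\varepsilon^2},$$ and, if moreover $m\ge 2$, $\varepsilon<\varepsilon_0$ and $\delta<1/100$, $$T_{\mathcal P_{\mathrm{all}}}(\varepsilon,\delta)\ \ge\ c\,\frac{m^{n-2}+\log(1/\delta)}{\varepsilon}.$$ -/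

import Mathlib

open scoped ENNReal

universe u

noncomputable section

namespace ForecastAggregation

/-- A joint distribution of the signals `s = (s 1, …, s n)` and the binary event `ω`
(`true` for `ω = 1`, `false` for `ω = 0`): a probability vector on the finite set
`(S 1 × ⋯ × S n) × {0, 1}`. -/
abbrev JointDist {n : ℕ} (S : Fin n → Type u) [∀ i, Fintype (S i)] : Type u :=
  ↥(stdSimplex ℝ ((∀ i, S i) × Bool))

/-- An aggregator `f : [0,1]^n → [0,1]`. The type carries the product σ-algebra. -/
abbrev Aggregator (n : ℕ) : Type :=
  (Fin n → unitInterval) → unitInterval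

/-- The numerical value (0 or 1) of the event. -/
def eventValue (ω : Bool) : ℝ := if ω then 1 else 0

variable {n : ℕ} {S : Fin n → Type u} [∀ i, Fintype (S i)]

open Classical in
/-- The marginal probability `P(s_i = a, ω)`. -/
def marginal (P : JointDist S) (i : Fin n) (a : S i) (ω : Bool) : ℝ :=
  ∑ s : ∀ i, S i, if s i = a then P.1 (s, ω) else 0

theorem marginal_nonneg (P : JointDist S) (i : Fin n) (a : S i) (ω : Bool) :
    0 ≤ marginal P i a ω := by
  refine Finset.sum_nonneg fun s _ => ?_
  split_ifs
  · exact P.2.1 _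
  · exact le_rfl

/-- The forecast of expert `i` on seeing the signal `a`:
`P(ω = 1 ∣ s_i = a) = P(s_i = a, ω = 1) / (P(s_i = a, ω = 1) + P(s_i = a, ω = 0))`.
It is `0` for a signal of probability zero, which is never observed. -/
def report (P : JointDist S) (i : Fin n) (a : S i) : unitInterval :=
  ⟨marginal P i a true / (marginal P i a true + marginal P i a false),
    unitInterval.div_mem (marginal_nonneg P i a true)
      (add_nonneg (marginal_nonneg P i a true) (marginal_nonneg P i a false))
      (le_add_of_nonneg_right (marginal_nonneg P i a false))⟩

/-- The joint report `r = (r 1, …, r n)` produced by the joint signal `s`. -/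
def reports (P : JointDist S) (s : ∀ i, S i) : Fin n → unitInterval :=
  fun i => report P i (s i)

/-- The mean squared loss `L_P(f) = E_P[|f(r) - ω|²]`. -/
def loss (P : JointDist S) (f : Aggregator n) : ℝ :=
  ∑ x : (∀ i, S i) × Bool, P.1 x * |(f (reports P x.1) : ℝ) - eventValue x.2| ^ 2

/-- `g` is an optimal aggregator for `P`: it minimizes the loss over all aggregators. -/
def IsOptimal (P : JointDist S) (g : Aggregator n) : Prop :=
  ∀ f : Aggregator n, loss P g ≤ loss P f

/-- The mean squared difference `E_P[|f(r) - g(r)|²]`. -/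
def sqDist (P : JointDist S) (f g : Aggregator n) : ℝ :=
  ∑ x : (∀ i, S i) × Bool,
    P.1 x * |(f (reports P x.1) : ℝ) - (g (reports P x.1) : ℝ)| ^ 2

/-- `f` is `ε`-optimal for `P`: `E_P[|f(r) - f*(r)|²] ≤ ε` for the optimal aggregator `f*`.
(Optimal aggregators exist and agree on all reports of positive probability.) -/
def IsEpsOptimal (P : JointDist S) (ε : ℝ) (f : Aggregator n) : Prop :=
  ∃ g : Aggregator n, IsOptimal P g ∧ sqDist P f g ≤ ε

/-- A (possibly randomized) learning procedure using `T` samples: it sees the reports and the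
events `(r^(t), ω^(t))`, `t < T`, and outputs a random aggregator, given by its law. -/
abbrev Learner (n T : ℕ) : Type :=
  (Fin T → (Fin n → unitInterval) × Bool) → MeasureTheory.ProbabilityMeasure (Aggregator n)

/-- The probability, over `T` i.i.d. draws `(s^(t), ω^(t))` from `P` and the randomness of the
learner, that the learner fed with `(r^(t), ω^(t))` outputs an `ε`-optimal aggregator. -/
def successProb (P : JointDist S) (ε : ℝ) {T : ℕ} (A : Learner n T) : ℝ :=
  ∑ x : Fin T → (∀ i, S i) × Bool, (∏ t, P.1 (x t)) *
    (A (fun t => (reports P (x t).1, (x t).2)) : MeasureTheory.Measure (Aggregator n)).real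
      {f | IsEpsOptimal P ε f}

/-- `T` samples suffice for the family `F`: one learner succeeds with probability at least
`1 - δ` on every distribution of the family. -/
def Suffices (F : Set (JointDist S)) (ε δ : ℝ) (T : ℕ) : Prop :=
  ∃ A : Learner n T, ∀ P ∈ F, 1 - δ ≤ successProb P ε A

/-- The sample complexity of forecast aggregation with respect to `F`: the least `T₀` such that
every number `T ≥ T₀` of samples suffices (`⊤` if there is none). -/
def sampleComplexity (F : Set (JointDist S)) (ε δ : ℝ) : ℕ∞ :=
  sInf ((fun T₀ : ℕ => (T₀ : ℕ∞)) '' {T₀ : ℕ | ∀ T : ℕ, T₀ ≤ T → Suffices F ε δ T})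

end ForecastAggregation

end

/-! Upper bound. Signals and event together take `2 * m ^ n` values. A Chernoff bound and a union
bound over all sets of values (`uniform_convergence`) control every empirical frequency up to `ε /
2`. Since reports are functions of signals, the true loss difference of any two aggregators then
exceeds the empirical one by at most `ε`, so an empirical risk minimizer has excess loss at most
`ε`. Strong convexity of the square loss (`IsOptimal.sqDist_le`) turns excess loss into squared
distance to the optimum.

Lower bound. Take signals uniform on a product set in which two experts use only two signals each,
and perturb an additive regression function by `±γ` in a 2×2 checkerboard on these two experts, with
an independent sign for each of the `m ^ (n - 2)` signal tuples of the others. Checkerboards vanish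
in every one-expert marginal, so the reports are the same for all sign patterns (`reports_dist_eq`);
the additive part makes them determine the signals (`reports_injOn`). Hence the optimum is the
regression function, and with `γ ^ 2 = 64 * ε` an `ε`-optimal aggregator gets at least 15/16 of the
signs right (`setOf_isEpsOptimal_subset`). Hellinger affinity then limits learning: testing all
signs `+` against all `-` costs order `log (1 / δ) / ε` samples (`log_le_of_suffices`), and guessing
most signs, by averaging over single flips as in Assouad's lemma, costs order `m ^ (n - 2) / ε`
(`card_cells_le_of_suffices`). -/

namespace ForecastAggregation

/-! ### Sums over samples -/

section Samples

variable {X : Type*} [Fintype X]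

theorem sum_prod_eq_one {p : X → ℝ} (hp : ∑ x, p x = 1) (T : ℕ) :
    ∑ x : Fin T → X, ∏ t, p (x t) = 1 := by
  rw [← Fintype.sum_pow, hp, one_pow]

open Classical in
/-- A Chernoff bound for sums of i.i.d. centred variables with values in `[-1, 1]`. -/
theorem chernoff_bound {p h : X → ℝ} (hp0 : ∀ x, 0 ≤ p x) (hp : ∑ x, p x = 1)
    (hh : ∀ x, |h x| ≤ 1) (hmean : ∑ x, p x * h x = 0) {η : ℝ} (hη0 : 0 ≤ η) (hη : η ≤ 2)
    (T : ℕ) :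
    ∑ x : Fin T → X, (∏ t, p (x t)) * (if T * η ≤ ∑ t, h (x t) then 1 else 0) ≤
      Real.exp (-(T * η ^ 2 / 4)) := by
  -- The exponential parameter `η / 2` is at most 1, so `exp y ≤ 1 + y + y ^ 2` applies; the linear
  -- term has mean zero.
  have hmgf : ∑ x, p x * Real.exp (η / 2 * h x) ≤ Real.exp (η ^ 2 / 4) := by
    have hpt (x : X) : p x * Real.exp (η / 2 * h x) ≤
        p x + η / 2 * (p x * h x) + p x * (η ^ 2 / 4) := by
      have h1 : |η / 2 * h x| ≤ 1 := by
        rw [abs_mul, abs_of_nonneg (by positivity)]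
        nlinarith [hh x, abs_nonneg (h x)]
      have h2 := (abs_le.1 (Real.abs_exp_sub_one_sub_id_le h1)).2
      have h3 : h x ^ 2 ≤ 1 := (sq_le_one_iff_abs_le_one _).2 (hh x)
      have h4 : Real.exp (η / 2 * h x) ≤ 1 + η / 2 * h x + η ^ 2 / 4 := by
        nlinarith [sq_nonneg η]
      nlinarith [mul_le_mul_of_nonneg_left h4 (hp0 x)]
    calc ∑ x, p x * Real.exp (η / 2 * h x)
        ≤ ∑ x, (p x + η / 2 * (p x * h x) + p x * (η ^ 2 / 4)) :=
          Finset.sum_le_sum fun x _ => hpt x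
      _ = η ^ 2 / 4 + 1 := by
          rw [Finset.sum_add_distrib, Finset.sum_add_distrib, ← Finset.mul_sum,
            ← Finset.sum_mul, hmean, hp]
          ring
      _ ≤ Real.exp (η ^ 2 / 4) := Real.add_one_le_exp _
  calc ∑ x : Fin T → X, (∏ t, p (x t)) * (if T * η ≤ ∑ t, h (x t) then 1 else 0)
      ≤ ∑ x : Fin T → X, Real.exp (-(T * η ^ 2 / 2)) *
          ∏ t, (p (x t) * Real.exp (η / 2 * h (x t))) := by
        refine Finset.sum_le_sum fun x _ => ?_
        rw [Finset.prod_mul_distrib, ← Real.exp_sum, mul_left_comm, ← Real.exp_add]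
        refine mul_le_mul_of_nonneg_left ?_ (Finset.prod_nonneg fun t _ => hp0 _)
        split_ifs with hx
        · refine Real.one_le_exp ?_
          rw [← Finset.mul_sum]
          nlinarith
        · positivity
    _ = Real.exp (-(T * η ^ 2 / 2)) * (∑ x, p x * Real.exp (η / 2 * h x)) ^ T := by
        rw [← Finset.mul_sum, Fintype.sum_pow]
    _ ≤ Real.exp (-(T * η ^ 2 / 2)) * Real.exp (η ^ 2 / 4) ^ T := by
        refine mul_le_mul_of_nonneg_left ?_ (Real.exp_pos _).le
        exact pow_le_pow_left₀
          (Finset.sum_nonneg fun x _ => mul_nonneg (hp0 x) (Real.exp_pos _).le) hmgf T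
    _ = Real.exp (-(T * η ^ 2 / 4)) := by
        rw [← Real.exp_nat_mul, ← Real.exp_add]
        ring_nf

/-- The signed excess of the indicator of `A` over its mean. -/
def centredIndicator [DecidableEq X] (p : X → ℝ) (A : Finset X) (x : X) : ℝ :=
  (if x ∈ A then 1 else 0) - ∑ y ∈ A, p y

theorem abs_centredIndicator_le [DecidableEq X] {p : X → ℝ} (hp0 : ∀ x, 0 ≤ p x)
    (hp : ∑ x, p x = 1) (A : Finset X) (x : X) : |centredIndicator p A x| ≤ 1 := by
  have h0 : 0 ≤ ∑ y ∈ A, p y := Finset.sum_nonneg fun y _ => hp0 y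
  have h1 : ∑ y ∈ A, p y ≤ 1 :=
    hp ▸ Finset.sum_le_sum_of_subset_of_nonneg (Finset.subset_univ A) fun y _ _ => hp0 y
  unfold centredIndicator
  rw [abs_le]
  split_ifs <;> constructor <;> linarith

theorem sum_mul_centredIndicator [DecidableEq X] {p : X → ℝ} (hp : ∑ x, p x = 1)
    (A : Finset X) : ∑ x, p x * centredIndicator p A x = 0 := by
  simp [centredIndicator, mul_sub, Finset.sum_sub_distrib, ← Finset.sum_mul, hp]

/-- If all empirical frequencies exceed the probabilities by at most `η`, then empirical means of
`[0, 1]`-valued functions exceed the true means by at most `η`. -/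
theorem empirical_mean_le [DecidableEq X] {p : X → ℝ} {T : ℕ} {η : ℝ} {x : Fin T → X}
    (hx : ∀ A : Finset X, ∑ t, centredIndicator p A (x t) ≤ T * η)
    {g : X → ℝ} (hg0 : ∀ y, 0 ≤ g y) (hg1 : ∀ y, g y ≤ 1) :
    ∑ t, g (x t) - T * ∑ y, p y * g y ≤ T * η := by
  set d : X → ℝ := fun y => (∑ t, if x t = y then 1 else 0) - T * p y with hd
  have hsum (f : X → ℝ) : ∑ t, f (x t) - T * ∑ y, p y * f y = ∑ y, d y * f y := by
    simp only [hd, sub_mul, Finset.sum_sub_distrib, Finset.sum_mul, Finset.mul_sum]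
    rw [Finset.sum_comm (s := Finset.univ (α := X))]
    simp [mul_assoc]
  -- Among functions with values in `[0, 1]`, the indicator of the over-represented points has the
  -- largest excess.
  set A : Finset X := Finset.univ.filter fun y => 0 ≤ d y with hA
  have hAsum : ∑ t, centredIndicator p A (x t) = ∑ y, d y * (if y ∈ A then 1 else 0) := by
    rw [← hsum]
    simp [centredIndicator, Finset.sum_sub_distrib]
  calc ∑ t, g (x t) - T * ∑ y, p y * g y = ∑ y, d y * g y := hsum g
    _ ≤ ∑ y, d y * (if y ∈ A then 1 else 0) := by
        refine Finset.sum_le_sum fun y _ => ?_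
        by_cases hy : 0 ≤ d y
        · have : y ∈ A := by simp [hA, hy]
          simpa [this] using mul_le_mul_of_nonneg_left (hg1 y) hy
        · have : y ∉ A := by simp [hA, hy]
          simpa [this] using mul_nonpos_of_nonpos_of_nonneg (not_le.1 hy).le (hg0 y)
    _ ≤ T * η := hAsum ▸ hx A

/-- Applying the one-sided bound to `(1 - g) / 2` reverses the direction of the deviation; the
rescaling costs the factor 2. -/
theorem mean_sub_empirical_mean_le [DecidableEq X] {p : X → ℝ} (hp : ∑ x, p x = 1)
    {T : ℕ} {η : ℝ} {x : Fin T → X}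
    (hx : ∀ A : Finset X, ∑ t, centredIndicator p A (x t) ≤ T * η)
    {g : X → ℝ} (hg : ∀ y, |g y| ≤ 1) :
    T * ∑ y, p y * g y - ∑ t, g (x t) ≤ 2 * (T * η) := by
  have h := empirical_mean_le hx (g := fun y => (1 - g y) / 2)
    (fun y => by linarith [(abs_le.1 (hg y)).2]) (fun y => by linarith [(abs_le.1 (hg y)).1])
  simp only [mul_div_assoc', ← Finset.sum_div, mul_sub, mul_one, Finset.sum_sub_distrib, hp,
    Finset.sum_const, Finset.card_univ, Fintype.card_fin, nsmul_eq_mul] at h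
  linarith

/-- Uniform convergence of the empirical frequencies of all events. -/
theorem uniform_convergence [DecidableEq X] {p : X → ℝ} (hp0 : ∀ x, 0 ≤ p x)
    (hp : ∑ x, p x = 1) {η : ℝ} (hη0 : 0 ≤ η) (hη : η ≤ 2) (T : ℕ) :
    1 - 2 ^ Fintype.card X * Real.exp (-(T * η ^ 2 / 4)) ≤
      ∑ x : Fin T → X, (∏ t, p (x t)) *
        {x : Fin T → X | ∀ A : Finset X,
          ∑ t, centredIndicator p A (x t) ≤ T * η}.indicator 1 x := by
  classical
  have hpt (x : Fin T → X) : 1 - ∑ A : Finset X,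
      (if T * η ≤ ∑ t, centredIndicator p A (x t) then (1 : ℝ) else 0) ≤
      {x : Fin T → X | ∀ A : Finset X,
          ∑ t, centredIndicator p A (x t) ≤ T * η}.indicator 1 x := by
    have hnn : ∀ A ∈ (Finset.univ : Finset (Finset X)),
        0 ≤ (if T * η ≤ ∑ t, centredIndicator p A (x t) then (1 : ℝ) else 0) :=
      fun A _ => by split_ifs <;> norm_num
    by_cases h : ∀ A : Finset X, ∑ t, centredIndicator p A (x t) ≤ T * η
    · rw [Set.indicator_of_mem (by exact h)]
      exact (sub_le_self _ (Finset.sum_nonneg hnn))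
    · rw [Set.indicator_of_notMem (by exact h)]
      push Not at h
      obtain ⟨A, hA⟩ := h
      have := Finset.single_le_sum hnn (Finset.mem_univ A)
      rw [if_pos hA.le] at this
      linarith
  calc 1 - 2 ^ Fintype.card X * Real.exp (-(T * η ^ 2 / 4))
      ≤ 1 - ∑ A : Finset X, ∑ x : Fin T → X, (∏ t, p (x t)) *
          (if T * η ≤ ∑ t, centredIndicator p A (x t) then (1 : ℝ) else 0) := by
        have := Finset.sum_le_card_nsmul (Finset.univ : Finset (Finset X)) _ _ fun A _ =>
          chernoff_bound hp0 hp (abs_centredIndicator_le hp0 hp A)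
            (sum_mul_centredIndicator hp A) hη0 hη T
        simp only [Finset.card_univ, Fintype.card_finset, nsmul_eq_mul, Nat.cast_pow,
          Nat.cast_ofNat] at this
        linarith
    _ = ∑ x : Fin T → X, (∏ t, p (x t)) * (1 - ∑ A : Finset X,
          (if T * η ≤ ∑ t, centredIndicator p A (x t) then (1 : ℝ) else 0)) := by
        simp only [mul_sub, mul_one, Finset.sum_sub_distrib, sum_prod_eq_one hp, Finset.mul_sum]
        rw [Finset.sum_comm]
    _ ≤ _ := Finset.sum_le_sum fun x _ =>
        mul_le_mul_of_nonneg_left (hpt x) (Finset.prod_nonneg fun t _ => hp0 _)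

end Samples

/-! ### Optimal aggregators and empirical risk minimization -/

section Optimal

variable {n : ℕ} {S : Fin n → Type u} [∀ i, Fintype (S i)]

/-- By Tychonoff the aggregators form a compact space, and the objective is continuous because it
reads finitely many coordinates. This serves both the true and the empirical loss. -/
theorem exists_forall_sum_sq_le {ι : Type*} [Fintype ι] (w : ι → ℝ)
    (r : ι → Fin n → unitInterval) (v : ι → ℝ) :
    ∃ g : Aggregator n, ∀ f : Aggregator n,
      ∑ i, w i * |(g (r i) : ℝ) - v i| ^ 2 ≤ ∑ i, w i * |(f (r i) : ℝ) - v i| ^ 2 := by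
  have hc : Continuous fun f : Aggregator n => ∑ i, w i * |(f (r i) : ℝ) - v i| ^ 2 := by
    fun_prop
  obtain ⟨g, -, hg⟩ := isCompact_univ.exists_isMinOn Set.univ_nonempty hc.continuousOn
  exact ⟨g, fun f => hg (Set.mem_univ f)⟩

theorem exists_isOptimal (P : JointDist S) : ∃ g : Aggregator n, IsOptimal P g :=
  exists_forall_sum_sq_le P.1 (fun x => reports P x.1) fun x => eventValue x.2

/-- Along the segment from `g` to `f` the loss is a quadratic with leading coefficient `sqDist P f
g`, and it is smallest at `g`. -/
theorem IsOptimal.sqDist_le {P : JointDist S} {g : Aggregator n} (hg : IsOptimal P g)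
    (f : Aggregator n) : sqDist P f g ≤ loss P f - loss P g := by
  have key (t : ℝ) (ht : t ∈ Set.Icc (0 : ℝ) 1) :
      loss P g ≤ (1 - t) * loss P g + t * loss P f - t * (1 - t) * sqDist P f g := by
    let h : Aggregator n := fun r => ⟨(1 - t) * g r + t * f r,
      (convex_Icc (0 : ℝ) 1) (g r).2 (f r).2 (by linarith [ht.2]) ht.1 (by ring)⟩
    refine (hg h).trans_eq ?_
    simp only [loss, sqDist, Finset.mul_sum, ← Finset.sum_add_distrib,
      ← Finset.sum_sub_distrib, sq_abs, h]
    exact Finset.sum_congr rfl fun x _ => by ring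
  have hfg := hg f
  by_contra! hlt
  set d := sqDist P f g
  set e := loss P f - loss P g with he
  have hd : 0 < d := by linarith
  -- Optimality at `t` gives `(1 - t) * d ≤ e`; this `t` makes the left side the midpoint of `d` and
  -- `e`, which exceeds `e`.
  have ht0 : 0 < (d - e) / (2 * d) := div_pos (by linarith) (by positivity)
  have ht1 : (d - e) / (2 * d) ≤ 1 := by rw [div_le_one (by positivity)]; linarith
  have h1 := key _ ⟨ht0.le, ht1⟩
  have h2 : (1 - (d - e) / (2 * d)) * d ≤ e := by nlinarith
  have h3 : (1 - (d - e) / (2 * d)) * d = (d + e) / 2 := by field_simp; ring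
  linarith

theorem abs_sub_eventValue_sq_mem (a : unitInterval) (ω : Bool) :
    |(a : ℝ) - eventValue ω| ^ 2 ∈ Set.Icc (0 : ℝ) 1 := by
  refine ⟨by positivity, ?_⟩
  rw [sq_abs, sq_le_one_iff_abs_le_one, abs_le]
  have h0 := a.2.1
  have h1 := a.2.2
  cases ω <;> simp [eventValue] <;> constructor <;> linarith

theorem exists_empirical_risk_minimizer {T : ℕ} (x : Fin T → (Fin n → unitInterval) × Bool) :
    ∃ g : Aggregator n, ∀ f : Aggregator n,
      ∑ t, |(g (x t).1 : ℝ) - eventValue (x t).2| ^ 2 ≤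
        ∑ t, |(f (x t).1 : ℝ) - eventValue (x t).2| ^ 2 := by
  simpa using exists_forall_sum_sq_le 1 (fun t => (x t).1) fun t => eventValue (x t).2

/-- The learner that outputs an empirical risk minimizer. -/
noncomputable def ermLearner (n T : ℕ) : Learner n T := fun x =>
  MeasureTheory.diracProba (exists_empirical_risk_minimizer x).choose

theorem le_successProb_ermLearner (P : JointDist S) {ε : ℝ} (hε0 : 0 < ε) (hε1 : ε < 1)
    {T : ℕ} (hT : 0 < T) :
    1 - 2 ^ Fintype.card ((∀ i, S i) × Bool) * Real.exp (-(T * ε ^ 2 / 16)) ≤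
      successProb P ε (ermLearner n T) := by
  classical
  have h := uniform_convergence P.2.1 P.2.2 (η := ε / 2) (by linarith) (by linarith) T
  rw [show (T * (ε / 2) ^ 2 / 4 : ℝ) = T * ε ^ 2 / 16 by ring] at h
  refine h.trans (Finset.sum_le_sum fun x _ =>
    mul_le_mul_of_nonneg_left ?_ (Finset.prod_nonneg fun t _ => P.2.1 _))
  by_cases hx : ∀ A : Finset ((∀ i, S i) × Bool),
      ∑ t, centredIndicator P.1 A (x t) ≤ T * (ε / 2)
  swap
  · rw [Set.indicator_of_notMem (by exact hx)]
    exact MeasureTheory.measureReal_nonneg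
  rw [Set.indicator_of_mem (by exact hx)]
  have herm := (exists_empirical_risk_minimizer
    fun t => (reports P (x t).1, (x t).2)).choose_spec
  set f := (exists_empirical_risk_minimizer
    fun t => (reports P (x t).1, (x t).2)).choose with hf
  have hmem : IsEpsOptimal P ε f := by
    obtain ⟨g, hg⟩ := exists_isOptimal P
    refine ⟨g, hg, (hg.sqDist_le f).trans ?_⟩
    -- The minimizer `f` depends on the sample, which is harmless because the deviation bound holds
    -- for all functions at once.
    have hdev := mean_sub_empirical_mean_le P.2.2 hx
      (g := fun y => |(f (reports P y.1) : ℝ) - eventValue y.2| ^ 2 -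
        |(g (reports P y.1) : ℝ) - eventValue y.2| ^ 2) fun y => by
          have h1 := abs_sub_eventValue_sq_mem (f (reports P y.1)) y.2
          have h2 := abs_sub_eventValue_sq_mem (g (reports P y.1)) y.2
          rw [abs_le]
          constructor <;> linarith [h1.1, h1.2, h2.1, h2.2]
    have hloss : ∑ y, P.1 y * (|(f (reports P y.1) : ℝ) - eventValue y.2| ^ 2 -
        |(g (reports P y.1) : ℝ) - eventValue y.2| ^ 2) = loss P f - loss P g := by
      simp only [loss, mul_sub, Finset.sum_sub_distrib]
    have hT' : (0 : ℝ) < T := by exact_mod_cast hT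
    have hfg := herm g
    simp only at hfg
    simp only [hloss, Finset.sum_sub_distrib] at hdev
    refine le_of_mul_le_mul_left ?_ hT'
    linarith
  have hone : ((MeasureTheory.diracProba f : MeasureTheory.ProbabilityMeasure (Aggregator n)) :
      MeasureTheory.Measure (Aggregator n)) {f | IsEpsOptimal P ε f} = 1 :=
    MeasureTheory.Measure.dirac_apply_of_mem hmem
  have : (ermLearner n T fun t => (reports P (x t).1, (x t).2)) =
      MeasureTheory.diracProba f := rfl
  rw [this, MeasureTheory.measureReal_def, hone]
  simp

theorem suffices_of_le (F : Set (JointDist S)) {m : ℕ} (hcard : ∀ i, Fintype.card (S i) = m)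
    {ε δ : ℝ} (hε0 : 0 < ε) (hε1 : ε < 1) (hδ0 : 0 < δ) {T : ℕ} (hT0 : 0 < T)
    (hT : 32 * (((m : ℝ) ^ n + Real.log (1 / δ)) / ε ^ 2) ≤ T) (hδ1 : δ < 1) :
    Suffices F ε δ T := by
  refine ⟨ermLearner n T, fun P _ => le_trans ?_ (le_successProb_ermLearner P hε0 hε1 hT0)⟩
  have hc : Fintype.card ((∀ i, S i) × Bool) = m ^ n * 2 := by
    simp [Fintype.card_pi, hcard]
  have h2 : (2 : ℝ) ^ (m ^ n * 2) ≤ Real.exp (2 * (m : ℝ) ^ n) := by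
    rw [show (2 * (m : ℝ) ^ n) = ((m ^ n * 2 : ℕ) : ℝ) * 1 by push_cast; ring,
      Real.exp_nat_mul]
    exact pow_le_pow_left₀ (by norm_num) (by linarith [Real.add_one_le_exp 1]) _
  have hlog : Real.exp (-Real.log (1 / δ)) = δ := by
    rw [one_div, Real.log_inv, neg_neg, Real.exp_log hδ0]
  have hlog0 : 0 ≤ Real.log (1 / δ) := Real.log_nonneg (by rw [le_div_iff₀ hδ0]; linarith)
  have hTε : 2 * ((m : ℝ) ^ n + Real.log (1 / δ)) ≤ T * ε ^ 2 / 16 := by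
    rw [← mul_div_assoc, div_le_iff₀ (by positivity)] at hT
    linarith
  have : (2 : ℝ) ^ (m ^ n * 2) * Real.exp (-(T * ε ^ 2 / 16)) ≤ δ := by
    calc (2 : ℝ) ^ (m ^ n * 2) * Real.exp (-(T * ε ^ 2 / 16))
        ≤ Real.exp (2 * (m : ℝ) ^ n) * Real.exp (-(T * ε ^ 2 / 16)) :=
          mul_le_mul_of_nonneg_right h2 (Real.exp_pos _).le
      _ ≤ Real.exp (-Real.log (1 / δ)) := by
          rw [← Real.exp_add]
          exact Real.exp_le_exp.2 (by linarith)
      _ = δ := hlog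
  rw [hc]
  linarith

theorem sampleComplexity_le (F : Set (JointDist S)) {m : ℕ} (hm : 1 ≤ m)
    (hcard : ∀ i, Fintype.card (S i) = m) {ε δ : ℝ} (hε0 : 0 < ε) (hε1 : ε < 1)
    (hδ0 : 0 < δ) (hδ1 : δ < 1) :
    ((sampleComplexity F ε δ : ℕ∞) : ℝ≥0∞) ≤
      ENNReal.ofReal (33 * (((m : ℝ) ^ n + Real.log (1 / δ)) / ε ^ 2)) := by
  set B : ℝ := ((m : ℝ) ^ n + Real.log (1 / δ)) / ε ^ 2 with hB
  have hlog0 : 0 ≤ Real.log (1 / δ) := Real.log_nonneg (by rw [le_div_iff₀ hδ0]; linarith)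
  have hm1 : (1 : ℝ) ≤ (m : ℝ) ^ n := one_le_pow₀ (by exact_mod_cast hm)
  -- This absorbs the rounding up to an integer, turning 32 into 33.
  have hB1 : 1 ≤ B := by
    rw [hB, le_div_iff₀ (by positivity)]
    nlinarith
  have hle : sampleComplexity F ε δ ≤ ((⌈32 * B⌉₊ : ℕ) : ℕ∞) := by
    refine sInf_le ⟨_, fun T hT => ?_, rfl⟩
    refine suffices_of_le F hcard hε0 hε1 hδ0 ?_ (Nat.ceil_le.1 hT) hδ1
    exact (Nat.ceil_pos.2 (by linarith)).trans_le hT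
  calc ((sampleComplexity F ε δ : ℕ∞) : ℝ≥0∞) ≤ (((⌈32 * B⌉₊ : ℕ) : ℕ∞) : ℝ≥0∞) :=
        ENat.toENNReal_le.2 hle
    _ = ENNReal.ofReal (⌈32 * B⌉₊ : ℝ) := by simp
    _ ≤ ENNReal.ofReal (33 * B) := by
        refine ENNReal.ofReal_le_ofReal ?_
        linarith [Nat.ceil_lt_add_one (a := 32 * B) (by linarith)]

end Optimal

end ForecastAggregation

namespace ForecastAggregation

/-! ### Testing two product distributions -/

section Affinity

variable {X : Type*} [Fintype X]

/-- The Bhattacharyya coefficient. -/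
noncomputable def affinity (p q : X → ℝ) : ℝ := ∑ x, √(p x * q x)

theorem affinity_nonneg (p q : X → ℝ) : 0 ≤ affinity p q :=
  Finset.sum_nonneg fun _ _ => Real.sqrt_nonneg _

theorem affinity_prod {p q : X → ℝ} (hp : ∀ x, 0 ≤ p x) (hq : ∀ x, 0 ≤ q x) (T : ℕ) :
    affinity (fun x : Fin T → X => ∏ t, p (x t)) (fun x => ∏ t, q (x t)) =
      affinity p q ^ T := by
  rw [affinity, affinity, Fintype.sum_pow]
  refine Finset.sum_congr rfl fun x _ => ?_
  rw [← Finset.prod_mul_distrib, Real.sqrt_prod _ fun t _ => mul_nonneg (hp _) (hq _)]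

/-- Cauchy–Schwarz for `p * q = min p q * max p q`: the maxima sum to at most 2, and the minima
bound the total error of the test `α` from below. -/
theorem affinity_sq_le {p q α : X → ℝ} (hp : ∀ x, 0 ≤ p x) (hq : ∀ x, 0 ≤ q x)
    (hp1 : ∑ x, p x = 1) (hq1 : ∑ x, q x = 1) (hα : ∀ x, α x ∈ Set.Icc (0 : ℝ) 1) :
    affinity p q ^ 2 ≤ 2 * ∑ x, (p x * α x + q x * (1 - α x)) := by
  have hmin (x : X) : 0 ≤ min (p x) (q x) := le_min (hp x) (hq x)
  have hmax (x : X) : 0 ≤ max (p x) (q x) := (hp x).trans (le_max_left _ _)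
  have h1 : ∑ x, min (p x) (q x) ≤ ∑ x, (p x * α x + q x * (1 - α x)) := by
    refine Finset.sum_le_sum fun x _ => ?_
    have h0 := (hα x).1
    have h1 := (hα x).2
    nlinarith [min_le_left (p x) (q x), min_le_right (p x) (q x)]
  have h2 : ∑ x, max (p x) (q x) ≤ 2 := by
    calc ∑ x, max (p x) (q x) ≤ ∑ x, (p x + q x) :=
          Finset.sum_le_sum fun x _ => max_le_add_of_nonneg (hp x) (hq x)
      _ = 2 := by rw [Finset.sum_add_distrib, hp1, hq1]; norm_num
  have h3 : affinity p q ^ 2 ≤ (∑ x, min (p x) (q x)) * ∑ x, max (p x) (q x) := by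
    have := Finset.sum_mul_sq_le_sq_mul_sq Finset.univ (fun x => √(min (p x) (q x)))
      fun x => √(max (p x) (q x))
    simpa only [affinity, ← Real.sqrt_mul (hmin _), min_mul_max, Real.sq_sqrt (hmin _),
      Real.sq_sqrt (hmax _)] using this
  nlinarith [Finset.sum_nonneg fun x (_ : x ∈ Finset.univ) => hmin x]

/-- Le Cam's two point bound for `T` i.i.d. samples. -/
theorem affinity_pow_le {p q : X → ℝ} (hp : ∀ x, 0 ≤ p x) (hq : ∀ x, 0 ≤ q x)
    (hp1 : ∑ x, p x = 1) (hq1 : ∑ x, q x = 1) {T : ℕ} {α : (Fin T → X) → ℝ}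
    (hα : ∀ x, α x ∈ Set.Icc (0 : ℝ) 1) :
    affinity p q ^ (2 * T) ≤
      2 * ∑ x : Fin T → X, ((∏ t, p (x t)) * α x + (∏ t, q (x t)) * (1 - α x)) := by
  rw [mul_comm 2 T, pow_mul, ← affinity_prod hp hq]
  exact affinity_sq_le (fun x => Finset.prod_nonneg fun t _ => hp _)
    (fun x => Finset.prod_nonneg fun t _ => hq _) (sum_prod_eq_one hp1 T)
    (sum_prod_eq_one hq1 T) hα

end Affinity

/-- For `γ > 0` the squared inequality reduces to `1 + 16 * γ ^ 2 ≤ 8 * b`, tight at `b = γ = 1 /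
4`. -/
theorem sub_sq_div_le_sqrt {b γ : ℝ} (hb : 1 / 4 ≤ b) (hγ0 : 0 ≤ γ) (hγ : γ ≤ 1 / 4) :
    b - 4 * γ ^ 2 ≤ √((b + γ) * (b - γ)) := by
  refine Real.le_sqrt_of_sq_le ?_
  nlinarith [sq_nonneg γ, mul_nonneg (sq_nonneg γ) (sub_nonneg.2 hb),
    mul_nonneg (sq_nonneg γ) (mul_nonneg (sub_nonneg.2 hγ) (add_nonneg hγ0 hγ0)),
    mul_nonneg (sq_nonneg γ) (mul_nonneg hγ0 (sub_nonneg.2 hγ))]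

theorem exp_neg_two_mul_le {a : ℝ} (ha0 : 0 ≤ a) (ha : a ≤ 1 / 2) :
    Real.exp (-(2 * a)) ≤ 1 - a := by
  rw [Real.exp_neg]
  refine inv_le_of_inv_le₀ (by linarith) ?_
  have h := Real.add_one_le_exp (2 * a)
  refine le_trans ?_ h
  rw [inv_le_iff_one_le_mul₀ (by linarith)]
  nlinarith

/-! ### The hard family -/

/-- The parameters of the hard family: two experts `i₀`, `i₁` who use only the signals `a`, `b`,
the regression function `1/2 + ∑ i, φ i (s i)` and the size `γ` of its perturbations. -/
structure HardFamily {n : ℕ} (S : Fin n → Type u) where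
  (i₀ i₁ : Fin n)
  (a b : ∀ i, S i)
  (φ : ∀ i, S i → ℝ)
  (γ : ℝ)
  ne : i₀ ≠ i₁
  ab₀ : a i₀ ≠ b i₀
  ab₁ : a i₁ ≠ b i₁
  φ_inj : ∀ i, Function.Injective (φ i)
  φ_nonneg : ∀ i x, 0 ≤ φ i x
  φ_sum_le : ∀ s : ∀ i, S i, ∑ i, φ i (s i) ≤ 1 / 8
  γ_nonneg : 0 ≤ γ
  γ_le : γ ≤ 1 / 4

/-- The sign `±1` of a Boolean. -/
def boolSign (t : Bool) : ℝ := if t then 1 else -1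

theorem boolSign_mul_self (t : Bool) : boolSign t * boolSign t = 1 := by
  cases t <;> norm_num [boolSign]

theorem boolSign_of_ne {t u : Bool} (h : t ≠ u) : boolSign u = -boolSign t := by
  cases t <;> cases u <;> simp_all [boolSign]

namespace HardFamily

open Classical

set_option linter.unusedSectionVars false

noncomputable section

variable {n : ℕ} {S : Fin n → Type u} [∀ i, Fintype (S i)] (H : HardFamily S)

/-- The experts with two signals. -/
def IsBinary (i : Fin n) : Prop := i = H.i₀ ∨ i = H.i₁

def support : Finset (∀ i, S i) :=
  Fintype.piFinset fun i => if H.IsBinary i then {H.a i, H.b i} else Finset.univ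

/-- The signals whose cells are perturbed independently. -/
def cells : Finset (∀ i, S i) :=
  Fintype.piFinset fun i => if H.IsBinary i then {H.a i} else Finset.univ

def cell (s : ∀ i, S i) : ∀ i, S i := fun i => if H.IsBinary i then H.a i else s i

def sgn (i : Fin n) (x : S i) : ℝ := if x = H.a i then 1 else if x = H.b i then -1 else 0

/-- On each fibre of `cell` in the support this is a 2×2 checkerboard in the signals of `i₀` and
`i₁`, with overall sign given by `τ`. -/
def perturbation (τ : (∀ i, S i) → Bool) (s : ∀ i, S i) : ℝ :=
  H.sgn H.i₀ (s H.i₀) * H.sgn H.i₁ (s H.i₁) * boolSign (τ (H.cell s))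

def base (s : ∀ i, S i) : ℝ := 1 / 2 + ∑ i, H.φ i (s i)

/-- The regression function. -/
def regression (τ : (∀ i, S i) → Bool) (s : ∀ i, S i) : ℝ :=
  H.base s + H.γ * H.perturbation τ s

/-- Used with `a`, `b` to negate the perturbation, and with two support points to match up slices.
-/
def swapAt (i : Fin n) (x y : ∀ i, S i) : (∀ i, S i) ≃ (∀ i, S i) :=
  Equiv.piCongrRight fun j => if j = i then Equiv.swap (x j) (y j) else Equiv.refl _

theorem swapAt_same (i : Fin n) (x y s : ∀ i, S i) :
    swapAt i x y s i = Equiv.swap (x i) (y i) (s i) := by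
  simp [swapAt]

theorem swapAt_of_ne {i j : Fin n} (h : j ≠ i) (x y s : ∀ i, S i) : swapAt i x y s j = s j := by
  simp [swapAt, h]

theorem mem_support {s : ∀ i, S i} :
    s ∈ H.support ↔ ∀ i, H.IsBinary i → s i = H.a i ∨ s i = H.b i := by
  simp only [support, Fintype.mem_piFinset]
  refine forall_congr' fun i => ?_
  split_ifs with h <;> simp [h]

theorem mem_cells {s : ∀ i, S i} : s ∈ H.cells ↔ ∀ i, H.IsBinary i → s i = H.a i := by
  simp only [cells, Fintype.mem_piFinset]
  refine forall_congr' fun i => ?_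
  split_ifs with h <;> simp [h]

theorem cells_subset_support : H.cells ⊆ H.support := fun _ hs =>
  H.mem_support.2 fun i hi => Or.inl (H.mem_cells.1 hs i hi)

theorem cell_mem_cells (s : ∀ i, S i) : H.cell s ∈ H.cells :=
  H.mem_cells.2 fun i hi => by simp [cell, hi]

theorem cell_eq_self {c : ∀ i, S i} (hc : c ∈ H.cells) : H.cell c = c := by
  funext i
  by_cases hi : H.IsBinary i
  · simp [cell, hi, H.mem_cells.1 hc i hi]
  · simp [cell, hi]

theorem isBinary_i₀ : H.IsBinary H.i₀ := Or.inl rfl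

theorem isBinary_i₁ : H.IsBinary H.i₁ := Or.inr rfl

theorem ab_ne {i : Fin n} (hi : H.IsBinary i) : H.a i ≠ H.b i := by
  obtain rfl | rfl := hi
  exacts [H.ab₀, H.ab₁]

theorem card_isBinary : (Finset.univ.filter fun i => H.IsBinary i).card = 2 := by
  have : (Finset.univ.filter fun i => H.IsBinary i) = {H.i₀, H.i₁} := by
    ext i
    simp only [Finset.mem_filter, Finset.mem_univ, true_and, Finset.mem_insert,
      Finset.mem_singleton]
    exact Iff.rfl
  rw [this, Finset.card_pair H.ne]

theorem card_not_isBinary : (Finset.univ.filter fun i => ¬ H.IsBinary i).card = n - 2 := by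
  have h := Finset.card_filter_add_card_filter_not (s := (Finset.univ : Finset (Fin n)))
    (fun i => H.IsBinary i)
  rw [card_isBinary, Finset.card_univ, Fintype.card_fin] at h
  omega

theorem card_support {m : ℕ} (hm : ∀ i, Fintype.card (S i) = m) :
    H.support.card = 4 * m ^ (n - 2) := by
  rw [support, Fintype.card_piFinset]
  have (i : Fin n) : (if H.IsBinary i then {H.a i, H.b i} else Finset.univ : Finset (S i)).card =
      if H.IsBinary i then 2 else m := by
    split_ifs with h
    · exact Finset.card_pair (H.ab_ne h)
    · exact hm i
  simp only [this, Finset.prod_ite, Finset.prod_const, card_isBinary, card_not_isBinary]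
  norm_num

theorem card_cells {m : ℕ} (hm : ∀ i, Fintype.card (S i) = m) :
    H.cells.card = m ^ (n - 2) := by
  rw [cells, Fintype.card_piFinset]
  have (i : Fin n) : (if H.IsBinary i then {H.a i} else Finset.univ : Finset (S i)).card =
      if H.IsBinary i then 1 else m := by
    split_ifs with h
    · simp
    · exact hm i
  simp only [this, Finset.prod_ite, Finset.prod_const, card_not_isBinary]
  norm_num

theorem cells_nonempty : H.cells.Nonempty := ⟨_, H.cell_mem_cells H.a⟩

theorem support_nonempty : H.support.Nonempty := H.cells_nonempty.mono H.cells_subset_support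

theorem card_support_pos : (0 : ℝ) < H.support.card :=
  Nat.cast_pos.2 H.support_nonempty.card_pos

theorem sgn_swap {i : Fin n} (hi : H.IsBinary i) (x : S i) :
    H.sgn i (Equiv.swap (H.a i) (H.b i) x) = -H.sgn i x := by
  have hab := H.ab_ne hi
  by_cases ha : x = H.a i
  · subst ha; simp [sgn, hab.symm]
  · by_cases hb : x = H.b i
    · subst hb; simp [sgn, hab.symm]
    · rw [Equiv.swap_apply_of_ne_of_ne ha hb]; simp [sgn, ha, hb]

theorem cell_swapAt {i : Fin n} (hi : H.IsBinary i) (x y s : ∀ i, S i) :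
    H.cell (swapAt i x y s) = H.cell s := by
  funext j
  by_cases hj : H.IsBinary j
  · simp [cell, hj]
  · have : j ≠ i := fun h => hj (h ▸ hi)
    simp [cell, hj, swapAt_of_ne this]

theorem perturbation_swapAt (τ : (∀ i, S i) → Bool) {i : Fin n} (hi : H.IsBinary i)
    (s : ∀ i, S i) :
    H.perturbation τ (swapAt i H.a H.b s) = -H.perturbation τ s := by
  simp only [perturbation, H.cell_swapAt hi]
  obtain rfl | rfl := hi
  · rw [swapAt_same, swapAt_of_ne H.ne.symm, H.sgn_swap H.isBinary_i₀]; ring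
  · rw [swapAt_same, swapAt_of_ne H.ne, H.sgn_swap H.isBinary_i₁]; ring

/-- Some binary expert `j` differs from `i`; swapping the two signals of `j` preserves the slice and
negates the perturbation. This is why two binary experts are needed. -/
theorem sum_slice_perturbation (τ : (∀ i, S i) → Bool) (i : Fin n) (x : S i) :
    ∑ s : ∀ i, S i, (if s i = x then H.perturbation τ s else 0) = 0 := by
  obtain ⟨j, hj, hij⟩ : ∃ j, H.IsBinary j ∧ i ≠ j := by
    by_cases h : i = H.i₀
    · exact ⟨H.i₁, H.isBinary_i₁, h ▸ H.ne⟩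
    · exact ⟨H.i₀, H.isBinary_i₀, h⟩
  have h := Equiv.sum_comp (swapAt j H.a H.b)
    fun s : ∀ i, S i => if s i = x then H.perturbation τ s else 0
  simp only [swapAt_of_ne hij, H.perturbation_swapAt τ hj] at h
  have h2 : ∑ s : ∀ i, S i, (if s i = x then -H.perturbation τ s else 0) =
      -∑ s : ∀ i, S i, (if s i = x then H.perturbation τ s else 0) := by
    rw [← Finset.sum_neg_distrib]
    exact Finset.sum_congr rfl fun s _ => by split_ifs <;> simp
  linarith

theorem perturbation_of_notMem (τ : (∀ i, S i) → Bool) {s : ∀ i, S i} (hs : s ∉ H.support) :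
    H.perturbation τ s = 0 := by
  rw [mem_support] at hs
  push Not at hs
  obtain ⟨i, hi, ha, hb⟩ := hs
  obtain rfl | rfl := hi <;> simp [perturbation, sgn, ha, hb]

theorem sgn_mul_self {i : Fin n} (hi : H.IsBinary i) {s : ∀ i, S i} (hs : s ∈ H.support) :
    H.sgn i (s i) * H.sgn i (s i) = 1 := by
  obtain h | h := H.mem_support.1 hs i hi
  · simp [sgn, h]
  · simp [sgn, h, (H.ab_ne hi).symm]

theorem perturbation_sq (τ : (∀ i, S i) → Bool) {s : ∀ i, S i} (hs : s ∈ H.support) :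
    H.perturbation τ s ^ 2 = 1 := by
  have h0 := H.sgn_mul_self H.isBinary_i₀ hs
  have h1 := H.sgn_mul_self H.isBinary_i₁ hs
  have h2 := boolSign_mul_self (τ (H.cell s))
  calc H.perturbation τ s ^ 2 = (H.sgn H.i₀ (s H.i₀) * H.sgn H.i₀ (s H.i₀)) *
        (H.sgn H.i₁ (s H.i₁) * H.sgn H.i₁ (s H.i₁)) *
        (boolSign (τ (H.cell s)) * boolSign (τ (H.cell s))) := by rw [perturbation]; ring
    _ = 1 := by rw [h0, h1, h2]; norm_num

theorem base_mem (s : ∀ i, S i) : H.base s ∈ Set.Icc (1 / 2 : ℝ) (5 / 8) := by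
  have h0 := Finset.sum_nonneg fun i (_ : i ∈ Finset.univ) => H.φ_nonneg i (s i)
  have h1 := H.φ_sum_le s
  constructor <;> rw [base] <;> linarith

theorem perturbation_of_mem_cells (τ : (∀ i, S i) → Bool) {c : ∀ i, S i} (hc : c ∈ H.cells) :
    H.perturbation τ c = boolSign (τ c) := by
  simp [perturbation, H.cell_eq_self hc, sgn, H.mem_cells.1 hc _ H.isBinary_i₀,
    H.mem_cells.1 hc _ H.isBinary_i₁]

theorem abs_perturbation_le (τ : (∀ i, S i) → Bool) (s : ∀ i, S i) :
    |H.perturbation τ s| ≤ 1 := by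
  by_cases hs : s ∈ H.support
  · exact ((sq_le_one_iff_abs_le_one _).1 (H.perturbation_sq τ hs).le)
  · simp [H.perturbation_of_notMem τ hs]

theorem regression_mem (τ : (∀ i, S i) → Bool) (s : ∀ i, S i) :
    H.regression τ s ∈ Set.Icc (0 : ℝ) 1 := by
  have h1 := abs_le.1 (H.abs_perturbation_le τ s)
  have h2 := H.base_mem s
  have h3 := H.γ_nonneg
  have h4 := H.γ_le
  have h5 : |H.γ * H.perturbation τ s| ≤ 1 / 4 := by
    rw [abs_mul, abs_of_nonneg h3]
    nlinarith [H.abs_perturbation_le τ s, abs_nonneg (H.perturbation τ s)]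
  have h6 := abs_le.1 h5
  constructor <;> rw [regression] <;> linarith [h2.1, h2.2, h6.1, h6.2]

/-- The part of the probabilities that does not depend on the perturbation. -/
def baseWeight (s : ∀ i, S i) (ω : Bool) : ℝ :=
  if s ∈ H.support then (if ω then H.base s else 1 - H.base s) else 0

def prob (τ : (∀ i, S i) → Bool) (x : (∀ i, S i) × Bool) : ℝ :=
  (H.support.card : ℝ)⁻¹ *
    (H.baseWeight x.1 x.2 + boolSign x.2 * H.γ * H.perturbation τ x.1)

theorem prob_of_mem (τ : (∀ i, S i) → Bool) {s : ∀ i, S i} (hs : s ∈ H.support) (ω : Bool) :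
    H.prob τ (s, ω) = (H.support.card : ℝ)⁻¹ *
      (if ω then H.regression τ s else 1 - H.regression τ s) := by
  cases ω <;> simp only [prob, baseWeight, hs, boolSign, regression, if_true, Bool.false_eq_true, if_false] <;>
    ring

theorem prob_of_notMem (τ : (∀ i, S i) → Bool) {s : ∀ i, S i} (hs : s ∉ H.support) (ω : Bool) :
    H.prob τ (s, ω) = 0 := by
  simp [prob, baseWeight, hs, H.perturbation_of_notMem τ hs]

theorem prob_nonneg (τ : (∀ i, S i) → Bool) (x : (∀ i, S i) × Bool) : 0 ≤ H.prob τ x := by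
  obtain ⟨s, ω⟩ := x
  by_cases hs : s ∈ H.support
  · rw [H.prob_of_mem τ hs]
    have h := H.regression_mem τ s
    refine mul_nonneg (by positivity) ?_
    split_ifs <;> linarith [h.1, h.2]
  · rw [H.prob_of_notMem τ hs]

/-- Sums weighted by the probabilities, as averages over the support. -/
theorem sum_prob_mul (τ : (∀ i, S i) → Bool) (F : (∀ i, S i) × Bool → ℝ) :
    ∑ x, H.prob τ x * F x = (H.support.card : ℝ)⁻¹ * ∑ s ∈ H.support,
      (H.regression τ s * F (s, true) + (1 - H.regression τ s) * F (s, false)) := by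
  rw [Fintype.sum_prod_type, Finset.mul_sum]
  symm
  refine Finset.sum_subset_zero_on_sdiff (Finset.subset_univ _) (fun s hs => ?_) fun s hs => ?_
  · simp [H.prob_of_notMem τ (Finset.mem_sdiff.1 hs).2]
  · simp [H.prob_of_mem τ hs]; ring

theorem sum_prob (τ : (∀ i, S i) → Bool) : ∑ x, H.prob τ x = 1 := by
  have h := H.sum_prob_mul τ fun _ => 1
  simp only [mul_one] at h
  rw [h]
  simp [H.card_support_pos.ne']

/-- The distribution with perturbation `τ`. -/
def dist (τ : (∀ i, S i) → Bool) : JointDist S := ⟨H.prob τ, H.prob_nonneg τ, H.sum_prob τ⟩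

theorem marginal_dist (τ : (∀ i, S i) → Bool) (i : Fin n) (x : S i) (ω : Bool) :
    marginal (H.dist τ) i x ω =
      (H.support.card : ℝ)⁻¹ * ∑ s : ∀ i, S i, if s i = x then H.baseWeight s ω else 0 := by
  have h : marginal (H.dist τ) i x ω =
      (H.support.card : ℝ)⁻¹ * (∑ s : ∀ i, S i, if s i = x then H.baseWeight s ω else 0) +
      (H.support.card : ℝ)⁻¹ * (boolSign ω * H.γ) *
        ∑ s : ∀ i, S i, (if s i = x then H.perturbation τ s else 0) := by
    rw [marginal, Finset.mul_sum, Finset.mul_sum, ← Finset.sum_add_distrib]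
    refine Finset.sum_congr rfl fun s _ => ?_
    split_ifs
    · simp only [dist, prob]; ring
    · ring
  rw [h, H.sum_slice_perturbation, mul_zero, add_zero]

theorem reports_dist_eq (τ τ' : (∀ i, S i) → Bool) :
    reports (H.dist τ) = reports (H.dist τ') := by
  funext s i
  simp only [reports, report, marginal_dist]

def slice (i : Fin n) (x : S i) : Finset (∀ i, S i) := H.support.filter fun s => s i = x

theorem report_dist (τ : (∀ i, S i) → Bool) (i : Fin n) (x : S i) :
    (report (H.dist τ) i x : ℝ) = (∑ s ∈ H.slice i x, H.base s) / (H.slice i x).card := by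
  have ht : ∑ s : ∀ i, S i, (if s i = x then H.baseWeight s true else 0) =
      ∑ s ∈ H.slice i x, H.base s := by
    rw [slice, Finset.sum_filter, ← Finset.sum_subset (Finset.subset_univ H.support)]
    · exact Finset.sum_congr rfl fun s hs => by simp [baseWeight, hs]
    · intro s _ hs; simp [baseWeight, hs]
  have hf : ∑ s : ∀ i, S i, (if s i = x then H.baseWeight s false else 0) =
      (H.slice i x).card - ∑ s ∈ H.slice i x, H.base s := by
    rw [Finset.card_eq_sum_ones, Nat.cast_sum, ← Finset.sum_sub_distrib, slice,
      Finset.sum_filter, ← Finset.sum_subset (Finset.subset_univ H.support)]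
    · exact Finset.sum_congr rfl fun s hs => by simp [baseWeight, hs]
    · intro s _ hs; simp [baseWeight, hs]
  simp only [report, marginal_dist, ht, hf]
  rw [← mul_add, mul_div_mul_left _ _ (inv_ne_zero H.card_support_pos.ne')]
  congr 1
  ring

theorem swapAt_mem_slice {i : Fin n} {s s' : ∀ i, S i} (hs : s ∈ H.support)
    (hs' : s' ∈ H.support) (v : ∀ i, S i) :
    v ∈ H.slice i (s i) ↔ swapAt i s s' v ∈ H.slice i (s' i) := by
  simp only [slice, Finset.mem_filter, swapAt_same]
  rw [Equiv.swap_apply_eq_iff, Equiv.swap_apply_right]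
  refine and_congr_left fun hv => ?_
  rw [mem_support, mem_support]
  refine forall₂_congr fun j hj => ?_
  by_cases hji : j = i
  · subst hji
    rw [swapAt_same, hv, Equiv.swap_apply_left]
    exact iff_of_true (H.mem_support.1 hs j hj) (H.mem_support.1 hs' j hj)
  · rw [swapAt_of_ne hji]

theorem base_swapAt {i : Fin n} {s s' v : ∀ i, S i} (hv : v i = s i) :
    H.base (swapAt i s s' v) = H.base v + (H.φ i (s' i) - H.φ i (s i)) := by
  have h1 := Finset.add_sum_erase Finset.univ (fun j => H.φ j (swapAt i s s' v j))
    (Finset.mem_univ i)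
  have h2 := Finset.add_sum_erase Finset.univ (fun j => H.φ j (v j)) (Finset.mem_univ i)
  have h3 : ∑ j ∈ Finset.univ.erase i, H.φ j (swapAt i s s' v j) =
      ∑ j ∈ Finset.univ.erase i, H.φ j (v j) :=
    Finset.sum_congr rfl fun j hj => by rw [swapAt_of_ne (Finset.ne_of_mem_erase hj)]
  have h4 : swapAt i s s' v i = s' i := by rw [swapAt_same, hv, Equiv.swap_apply_left]
  simp only [h4, hv] at h1 h2
  rw [base, base, ← h1, ← h2, h3]
  ring

/-- On the support the reports reveal the signals. -/
theorem reports_injOn (τ : (∀ i, S i) → Bool) {s s' : ∀ i, S i} (hs : s ∈ H.support)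
    (hs' : s' ∈ H.support) (h : reports (H.dist τ) s = reports (H.dist τ) s') : s = s' := by
  funext i
  have hi : (report (H.dist τ) i (s i) : ℝ) = report (H.dist τ) i (s' i) :=
    congrArg Subtype.val (congrFun h i)
  have hcard : (H.slice i (s i)).card = (H.slice i (s' i)).card :=
    Finset.card_equiv (swapAt i s s') fun v => H.swapAt_mem_slice hs hs' v
  -- The reports are averages of `base` over equinumerous slices, and the swap shifts `base` by a
  -- constant difference of `φ i`; equal reports force this difference to vanish.
  have hsum : ∑ v ∈ H.slice i (s' i), H.base v =
      ∑ v ∈ H.slice i (s i), (H.base v + (H.φ i (s' i) - H.φ i (s i))) :=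
    (Finset.sum_equiv (swapAt i s s') (fun v => H.swapAt_mem_slice hs hs' v) fun v hv =>
      (H.base_swapAt (Finset.mem_filter.1 hv).2).symm).symm
  have hpos : (0 : ℝ) < (H.slice i (s i)).card :=
    Nat.cast_pos.2 (Finset.card_pos.2 ⟨s, Finset.mem_filter.2 ⟨hs, rfl⟩⟩)
  rw [report_dist, report_dist, ← hcard, hsum, div_left_inj' hpos.ne',
    Finset.sum_add_distrib, Finset.sum_const, nsmul_eq_mul, left_eq_add,
    mul_eq_zero, or_iff_right hpos.ne', sub_eq_zero] at hi
  exact H.φ_inj i hi.symm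

/-! ### Errors of aggregators on the hard family -/

theorem loss_dist (τ : (∀ i, S i) → Bool) (f : Aggregator n) :
    loss (H.dist τ) f = (H.support.card : ℝ)⁻¹ * ∑ s ∈ H.support,
      (((f (reports (H.dist τ) s) : ℝ) - H.regression τ s) ^ 2 +
        H.regression τ s * (1 - H.regression τ s)) := by
  have h := H.sum_prob_mul τ
    fun x => |(f (reports (H.dist τ) x.1) : ℝ) - eventValue x.2| ^ 2
  refine h.trans (congrArg _ (Finset.sum_congr rfl fun s _ => ?_))
  simp only [sq_abs, eventValue]
  simp
  ring

theorem sqDist_dist (τ : (∀ i, S i) → Bool) (f g : Aggregator n) :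
    sqDist (H.dist τ) f g = (H.support.card : ℝ)⁻¹ * ∑ s ∈ H.support,
      ((f (reports (H.dist τ) s) : ℝ) - g (reports (H.dist τ) s)) ^ 2 := by
  have h := H.sum_prob_mul τ
    fun x => |(f (reports (H.dist τ) x.1) : ℝ) - g (reports (H.dist τ) x.1)| ^ 2
  refine h.trans (congrArg _ (Finset.sum_congr rfl fun s _ => ?_))
  simp only [sq_abs]
  ring

theorem exists_eq_regression (τ : (∀ i, S i) → Bool) : ∃ g : Aggregator n,
    ∀ s ∈ H.support, (g (reports (H.dist τ) s) : ℝ) = H.regression τ s := by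
  refine ⟨fun r => if h : ∃ s ∈ H.support, reports (H.dist τ) s = r then
    ⟨H.regression τ h.choose, H.regression_mem τ _⟩ else 0, fun s hs => ?_⟩
  have h : ∃ s' ∈ H.support, reports (H.dist τ) s' = reports (H.dist τ) s := ⟨s, hs, rfl⟩
  have he := H.reports_injOn τ h.choose_spec.1 hs h.choose_spec.2
  simp only [dif_pos h, he]

/-- The loss is the mean squared distance to the regression function plus a constant, and some
aggregator makes that distance zero. -/
theorem eq_regression_of_isOptimal {τ : (∀ i, S i) → Bool} {g : Aggregator n}
    (hg : IsOptimal (H.dist τ) g) {s : ∀ i, S i} (hs : s ∈ H.support) :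
    (g (reports (H.dist τ) s) : ℝ) = H.regression τ s := by
  obtain ⟨g', hg'⟩ := H.exists_eq_regression τ
  have h := hg g'
  rw [loss_dist, loss_dist, mul_le_mul_iff_right₀ (inv_pos.2 H.card_support_pos),
    Finset.sum_add_distrib, Finset.sum_add_distrib, add_le_add_iff_right,
    Finset.sum_eq_zero (s := H.support)
      (f := fun s => ((g' (reports (H.dist τ) s) : ℝ) - H.regression τ s) ^ 2)
      fun s hs => by rw [hg' s hs]; ring] at h
  have h0 := (Finset.sum_eq_zero_iff_of_nonneg fun s _ => sq_nonneg _).1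
    (le_antisymm h (Finset.sum_nonneg fun s _ => sq_nonneg _)) s hs
  exact sub_eq_zero.1 (pow_eq_zero_iff two_ne_zero |>.1 h0)

/-- The common reports of the distributions of the family. -/
def rep (s : ∀ i, S i) : Fin n → unitInterval := reports (H.dist fun _ => true) s

theorem reports_dist (τ : (∀ i, S i) → Bool) : reports (H.dist τ) = H.rep :=
  H.reports_dist_eq τ _

/-- The aggregators that predict a positive perturbation in the cell `c`. -/
def positiveAt (c : ∀ i, S i) : Set (Aggregator n) := {f | H.base c ≤ f (H.rep c)}

/-- The aggregators that mispredict the perturbation `τ` in the cell `c`. -/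
def wrongAt (τ : (∀ i, S i) → Bool) (c : ∀ i, S i) : Set (Aggregator n) :=
  if τ c then (H.positiveAt c)ᶜ else H.positiveAt c

theorem measurableSet_wrongAt (τ : (∀ i, S i) → Bool) (c : ∀ i, S i) :
    MeasurableSet (H.wrongAt τ c) := by
  have h : MeasurableSet (H.positiveAt c) :=
    measurableSet_le measurable_const (measurable_subtype_coe.comp (measurable_pi_apply _))
  unfold wrongAt
  split_ifs
  exacts [h.compl, h]

theorem wrongAt_of_ne {τ τ' : (∀ i, S i) → Bool} {c : ∀ i, S i} (h : τ c ≠ τ' c) :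
    H.wrongAt τ' c = (H.wrongAt τ c)ᶜ := by
  unfold wrongAt
  cases h1 : τ c <;> cases h2 : τ' c <;> simp_all

/-- The number of cells in which an aggregator is wrong. -/
def wrongCount (τ : (∀ i, S i) → Bool) (f : Aggregator n) : ℝ :=
  ∑ c ∈ H.cells, (H.wrongAt τ c).indicator 1 f

/-- In a wrong cell `f` lies on the other side of `base` from the optimum, hence at distance at
least `γ` from it. -/
theorem wrongCount_le {τ : (∀ i, S i) → Bool} {ε : ℝ} {f : Aggregator n}
    (hf : IsEpsOptimal (H.dist τ) ε f) :
    H.wrongCount τ f * H.γ ^ 2 ≤ H.support.card * ε := by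
  obtain ⟨g, hg, hfg⟩ := hf
  rw [sqDist_dist, inv_mul_le_iff₀ H.card_support_pos] at hfg
  refine le_trans ?_ hfg
  rw [wrongCount, Finset.sum_mul]
  refine le_trans (Finset.sum_le_sum fun c hc => ?_)
    (Finset.sum_le_sum_of_subset_of_nonneg H.cells_subset_support fun s _ _ => sq_nonneg _)
  rw [H.eq_regression_of_isOptimal hg (H.cells_subset_support hc), regression,
    H.perturbation_of_mem_cells τ hc, H.reports_dist]
  have hγ := H.γ_nonneg
  by_cases hw : f ∈ H.wrongAt τ c
  · rw [Set.indicator_of_mem hw, Pi.one_apply, one_mul]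
    unfold wrongAt positiveAt at hw
    cases h : τ c
    · simp [h] at hw
      simp only [boolSign]
      simp
      nlinarith
    · simp [h] at hw
      simp only [boolSign]
      simp
      nlinarith
  · rw [Set.indicator_of_notMem hw, zero_mul]
    positivity

theorem wrongCount_add {τ τ' : (∀ i, S i) → Bool} (h : ∀ c, τ c ≠ τ' c) (f : Aggregator n) :
    H.wrongCount τ f + H.wrongCount τ' f = H.cells.card := by
  rw [wrongCount, wrongCount, ← Finset.sum_add_distrib, Finset.card_eq_sum_ones, Nat.cast_sum]
  refine Finset.sum_congr rfl fun c _ => ?_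
  rw [H.wrongAt_of_ne (h c)]
  by_cases hf : f ∈ H.wrongAt τ c <;> simp [hf]

theorem measurable_wrongCount (τ : (∀ i, S i) → Bool) : Measurable (H.wrongCount τ) :=
  Finset.measurable_fun_sum _ fun c _ =>
    measurable_one.indicator (H.measurableSet_wrongAt τ c)

/-! ### Affinities of the hard family -/

theorem le_affinity (τ τ' : (∀ i, S i) → Bool) :
    1 - 8 * H.γ ^ 2 * ((H.support.filter fun s => τ (H.cell s) ≠ τ' (H.cell s)).card : ℝ) /
      (H.support.card : ℝ) ≤ affinity (H.prob τ) (H.prob τ') := by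
  have hK := H.card_support_pos
  set K : ℝ := (H.support.card : ℝ) with hKdef
  have hpt (s : ∀ i, S i) (hs : s ∈ H.support) :
      K⁻¹ * (1 - 8 * H.γ ^ 2 * (if τ (H.cell s) ≠ τ' (H.cell s) then 1 else 0)) ≤
        √(H.prob τ (s, true) * H.prob τ' (s, true)) +
          √(H.prob τ (s, false) * H.prob τ' (s, false)) := by
    have hsq (u v : ℝ) : √(K⁻¹ * u * (K⁻¹ * v)) = K⁻¹ * √(u * v) := by
      rw [show K⁻¹ * u * (K⁻¹ * v) = K⁻¹ ^ 2 * (u * v) by ring,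
        Real.sqrt_mul (sq_nonneg _), Real.sqrt_sq (inv_pos.2 hK).le]
    simp only [H.prob_of_mem _ hs, ← hKdef, hsq, ← mul_add]
    refine mul_le_mul_of_nonneg_left ?_ (inv_pos.2 hK).le
    simp only [if_true, Bool.false_eq_true, if_false]
    have hb := H.base_mem s
    have hq := H.regression_mem τ s
    by_cases hτ : τ (H.cell s) = τ' (H.cell s)
    · have : H.regression τ' s = H.regression τ s := by
        simp only [regression, perturbation, hτ]
      rw [this, Real.sqrt_mul_self hq.1, Real.sqrt_mul_self (by linarith [hq.2])]
      simp [hτ]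
    · have hσ : H.perturbation τ' s = -H.perturbation τ s := by
        simp only [perturbation, boolSign_of_ne hτ]; ring
      have hprod : H.regression τ s * H.regression τ' s =
          (H.base s + H.γ) * (H.base s - H.γ) := by
        have := H.perturbation_sq τ hs
        rw [regression, regression, hσ]
        linear_combination -H.γ ^ 2 * this
      have hprod' : (1 - H.regression τ s) * (1 - H.regression τ' s) =
          (1 - H.base s + H.γ) * (1 - H.base s - H.γ) := by
        have := H.perturbation_sq τ hs
        rw [regression, regression, hσ]
        linear_combination -H.γ ^ 2 * this
      rw [hprod, hprod']
      -- Each of the two outcomes loses `4 * γ ^ 2`, which gives the constant 8.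
      have h1 := sub_sq_div_le_sqrt (b := H.base s) (by linarith [hb.1]) H.γ_nonneg H.γ_le
      have h2 := sub_sq_div_le_sqrt (b := 1 - H.base s) (by linarith [hb.2]) H.γ_nonneg H.γ_le
      simp [hτ]
      linarith
  calc 1 - 8 * H.γ ^ 2 * (H.support.filter fun s => τ (H.cell s) ≠ τ' (H.cell s)).card / K
      = ∑ s ∈ H.support,
          K⁻¹ * (1 - 8 * H.γ ^ 2 * (if τ (H.cell s) ≠ τ' (H.cell s) then 1 else 0)) := by
        rw [← Finset.mul_sum, Finset.sum_sub_distrib, ← Finset.mul_sum, Finset.sum_boole,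
          Finset.sum_const, nsmul_eq_mul, ← hKdef]
        field_simp
    _ ≤ ∑ s ∈ H.support, (√(H.prob τ (s, true) * H.prob τ' (s, true)) +
          √(H.prob τ (s, false) * H.prob τ' (s, false))) := Finset.sum_le_sum hpt
    _ ≤ affinity (H.prob τ) (H.prob τ') := by
        rw [affinity, Fintype.sum_prod_type]
        simp only [Fintype.sum_bool]
        exact Finset.sum_le_sum_of_subset_of_nonneg (Finset.subset_univ _)
          fun s _ _ => add_nonneg (Real.sqrt_nonneg _) (Real.sqrt_nonneg _)

end

end HardFamily

end ForecastAggregation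

/-! ### Sample size lower bounds from the hard family -/

namespace ForecastAggregation

open MeasureTheory

namespace HardFamily

open Classical

noncomputable section

set_option linter.unusedSectionVars false

variable {n : ℕ} {S : Fin n → Type u} [∀ i, Fintype (S i)] (H : HardFamily S)

/-- The aggregators that are wrong in at most a sixteenth of the cells. -/
def mostlyRight (τ : (∀ i, S i) → Bool) : Set (Aggregator n) :=
  {f | H.wrongCount τ f ≤ H.cells.card / 16}

theorem measurableSet_mostlyRight (τ : (∀ i, S i) → Bool) :
    MeasurableSet (H.mostlyRight τ) :=
  measurableSet_le (H.measurable_wrongCount τ) measurable_const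

theorem card_support_eq {m : ℕ} (hm : ∀ i, Fintype.card (S i) = m) :
    (H.support.card : ℝ) = 4 * H.cells.card := by
  rw [H.card_support hm, H.card_cells hm]
  push_cast
  ring

theorem card_cells_pos : (0 : ℝ) < H.cells.card := Nat.cast_pos.2 H.cells_nonempty.card_pos

/-- The support has four points per cell, so the number of wrong cells is at most `4 * ε / γ ^ 2 = 1
/ 16` of all cells. The larger set is measurable, as it constrains finitely many coordinates. -/
theorem setOf_isEpsOptimal_subset {m : ℕ} (hm : ∀ i, Fintype.card (S i) = m) {ε : ℝ}
    (hε : 0 < ε) (hγ : H.γ ^ 2 = 64 * ε) (τ : (∀ i, S i) → Bool) :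
    {f | IsEpsOptimal (H.dist τ) ε f} ⊆ H.mostlyRight τ := fun f hf => by
  have h := H.wrongCount_le hf
  rw [hγ, H.card_support_eq hm] at h
  rw [mostlyRight, Set.mem_ofPred_eq]
  nlinarith

theorem disjoint_mostlyRight {τ τ' : (∀ i, S i) → Bool} (h : ∀ c, τ c ≠ τ' c) :
    Disjoint (H.mostlyRight τ) (H.mostlyRight τ') := by
  refine Set.disjoint_left.2 fun f hf hf' => ?_
  have h1 := H.wrongCount_add h f
  have h2 := H.card_cells_pos
  rw [mostlyRight, Set.mem_ofPred_eq] at hf hf'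
  linarith

/-- The left side is the expected number of wrong cells: at most a sixteenth of them on
`mostlyRight`, at most all of them elsewhere. -/
theorem sum_measure_wrongAt_le (τ : (∀ i, S i) → Bool) (μ : Measure (Aggregator n))
    [IsProbabilityMeasure μ] :
    ∑ c ∈ H.cells, μ.real (H.wrongAt τ c) ≤
      H.cells.card * (1 / 16 + 1 - μ.real (H.mostlyRight τ)) := by
  have hint (c : ∀ i, S i) :
      Integrable ((H.wrongAt τ c).indicator (1 : Aggregator n → ℝ)) μ :=
    (integrable_const (1 : ℝ)).indicator (H.measurableSet_wrongAt τ c)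
  have h1 : ∫ f, H.wrongCount τ f ∂μ = ∑ c ∈ H.cells, μ.real (H.wrongAt τ c) := by
    simp only [wrongCount]
    rw [integral_finsetSum _ fun c _ => hint c]
    exact Finset.sum_congr rfl fun c _ => integral_indicator_one (H.measurableSet_wrongAt τ c)
  have hR := (H.measurableSet_mostlyRight τ).compl
  have hpt (f : Aggregator n) : H.wrongCount τ f ≤
      H.cells.card / 16 + H.cells.card * (H.mostlyRight τ)ᶜ.indicator 1 f := by
    by_cases hf : f ∈ H.mostlyRight τ
    · have h : H.wrongCount τ f ≤ H.cells.card / 16 := hf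
      simpa [hf] using h
    · have h0 : H.wrongCount τ f ≤ ∑ c ∈ H.cells, (1 : ℝ) :=
        Finset.sum_le_sum fun c _ => Set.indicator_le_self' (fun _ _ => zero_le_one) f
      have := H.card_cells_pos
      simp [hf] at h0 ⊢
      linarith
  have hint' : Integrable
      (fun f => (H.cells.card : ℝ) * (H.mostlyRight τ)ᶜ.indicator 1 f) μ :=
    ((integrable_const (1 : ℝ)).indicator hR).const_mul _
  have h2 := integral_mono (integrable_finsetSum _ fun c _ => hint c)
    ((integrable_const _).add hint') hpt
  rw [← h1]
  refine h2.trans_eq ?_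
  simp only [Pi.add_apply]
  rw [integral_add (integrable_const _) hint', integral_const, integral_const_mul,
    integral_indicator_one hR, probReal_compl_eq_one_sub (H.measurableSet_mostlyRight τ)]
  simp
  ring

/-- The observations made by a learner. -/
def observe {T : ℕ} (x : Fin T → (∀ i, S i) × Bool) : Fin T → (Fin n → unitInterval) × Bool :=
  fun t => (H.rep (x t).1, (x t).2)

/-- The law of the output of a learner. -/
def output {T : ℕ} (A : Learner n T) (x : Fin T → (∀ i, S i) × Bool) :
    Measure (Aggregator n) := A (H.observe x)

instance {T : ℕ} (A : Learner n T) (x : Fin T → (∀ i, S i) × Bool) :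
    IsProbabilityMeasure (H.output A x) :=
  inferInstanceAs (IsProbabilityMeasure (A (H.observe x) : Measure (Aggregator n)))

/-- The expectation of `F` over `T` samples. -/
def expect (τ : (∀ i, S i) → Bool) {T : ℕ} (F : (Fin T → (∀ i, S i) × Bool) → ℝ) : ℝ :=
  ∑ x, (∏ t, H.prob τ (x t)) * F x

theorem prod_prob_nonneg (τ : (∀ i, S i) → Bool) {T : ℕ} (x : Fin T → (∀ i, S i) × Bool) :
    0 ≤ ∏ t, H.prob τ (x t) := Finset.prod_nonneg fun _ _ => H.prob_nonneg τ _

theorem expect_mono (τ : (∀ i, S i) → Bool) {T : ℕ}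
    {F G : (Fin T → (∀ i, S i) × Bool) → ℝ} (h : ∀ x, F x ≤ G x) :
    H.expect τ F ≤ H.expect τ G :=
  Finset.sum_le_sum fun x _ => mul_le_mul_of_nonneg_left (h x) (H.prod_prob_nonneg τ x)

theorem expect_one_sub (τ : (∀ i, S i) → Bool) {T : ℕ}
    (F : (Fin T → (∀ i, S i) × Bool) → ℝ) :
    H.expect τ (fun x => 1 - F x) = 1 - H.expect τ F := by
  simp only [expect, mul_sub, mul_one, Finset.sum_sub_distrib, sum_prod_eq_one (H.sum_prob τ)]

theorem successProb_le {m : ℕ} (hm : ∀ i, Fintype.card (S i) = m) {ε : ℝ} (hε : 0 < ε)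
    (hγ : H.γ ^ 2 = 64 * ε) (τ : (∀ i, S i) → Bool) {T : ℕ} (A : Learner n T) :
    successProb (H.dist τ) ε A ≤
      H.expect τ fun x => (H.output A x).real (H.mostlyRight τ) := by
  rw [successProb, H.reports_dist]
  exact H.expect_mono τ fun x =>
    measureReal_mono (μ := H.output A x) (H.setOf_isEpsOptimal_subset hm hε hγ τ)

theorem affinity_pow_le_expect (τ τ' : (∀ i, S i) → Bool) {T : ℕ}
    {α : (Fin T → (∀ i, S i) × Bool) → ℝ} (hα : ∀ x, α x ∈ Set.Icc (0 : ℝ) 1) :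
    affinity (H.prob τ) (H.prob τ') ^ (2 * T) ≤
      2 * (H.expect τ α + H.expect τ' fun x => 1 - α x) := by
  refine (affinity_pow_le (H.prob_nonneg τ) (H.prob_nonneg τ') (H.sum_prob τ) (H.sum_prob τ')
    hα).trans_eq ?_
  rw [Finset.sum_add_distrib, expect, expect]

theorem measureReal_mem_Icc {T : ℕ} (A : Learner n T) (x : Fin T → (∀ i, S i) × Bool)
    (E : Set (Aggregator n)) : (H.output A x).real E ∈ Set.Icc (0 : ℝ) 1 :=
  ⟨measureReal_nonneg, measureReal_le_one⟩

/-- The dependence on `δ`: testing the two constant perturbations against each other. -/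
theorem log_le_of_suffices {m : ℕ} (hm : ∀ i, Fintype.card (S i) = m) {ε δ : ℝ} (hε : 0 < ε)
    (hγ : H.γ ^ 2 = 64 * ε) (hδ0 : 0 < δ) (hδ : δ < 1 / 100) {T : ℕ}
    (hT : Suffices (Set.univ : Set (JointDist S)) ε δ T) :
    Real.log (1 / δ) ≤ 4096 * ε * T := by
  obtain ⟨A, hA⟩ := hT
  let τ : (∀ i, S i) → Bool := fun _ => true
  let τ' : (∀ i, S i) → Bool := fun _ => false
  have h1 := (hA _ (Set.mem_univ _)).trans (H.successProb_le hm hε hγ τ A)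
  have h2 := (hA _ (Set.mem_univ _)).trans (H.successProb_le hm hε hγ τ' A)
  have h3 := H.affinity_pow_le_expect τ' τ
    (fun x => H.measureReal_mem_Icc A x (H.mostlyRight τ))
  rw [H.expect_one_sub] at h3
  have h4 : H.expect τ' (fun x => (H.output A x).real (H.mostlyRight τ)) ≤
      1 - H.expect τ' fun x => (H.output A x).real (H.mostlyRight τ') := by
    rw [← H.expect_one_sub]
    refine H.expect_mono τ' fun x => ?_
    rw [← probReal_compl_eq_one_sub (H.measurableSet_mostlyRight τ')]
    exact measureReal_mono (H.disjoint_mostlyRight fun c => by simp [τ, τ']).subset_compl_right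
  have h5 := H.le_affinity τ' τ
  have hγ1 : H.γ ^ 2 ≤ (1 / 4) ^ 2 := pow_le_pow_left₀ H.γ_nonneg H.γ_le 2
  have h6 : 1 - 512 * ε ≤ affinity (H.prob τ') (H.prob τ) := by
    refine le_trans ?_ h5
    have : ((H.support.filter fun s => τ' (H.cell s) ≠ τ (H.cell s)).card : ℝ) ≤
        H.support.card := by exact_mod_cast Finset.card_filter_le _ _
    have := div_le_one_of_le₀ this H.card_support_pos.le
    rw [mul_div_assoc, hγ]
    nlinarith
  have h7 := exp_neg_two_mul_le (a := 512 * ε) (by positivity) (by linarith)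
  have h8 : Real.exp (-(2 * (512 * ε))) ^ (2 * T) ≤ 4 * δ :=
    (pow_le_pow_left₀ (Real.exp_pos _).le (h7.trans h6) _).trans (by linarith)
  rw [← Real.exp_nat_mul] at h8
  have h9 := (Real.le_log_iff_exp_le (by positivity)).2 h8
  -- For `δ ≤ 1 / 16` one has `4 * δ ≤ √δ`.
  have h10 : Real.log (4 * δ) ≤ Real.log (1 / δ) * (-1 / 2) := by
    have : Real.log ((4 * δ) ^ 2) ≤ Real.log δ :=
      Real.log_le_log (by positivity) (by nlinarith)
    rw [Real.log_pow] at this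
    rw [one_div, Real.log_inv]
    push_cast at this
    linarith
  push_cast at h9
  linarith

/-- Flipping the perturbation in the cell `c`. -/
def flipAt (c : ∀ i, S i) : Equiv.Perm ((∀ i, S i) → Bool) :=
  Function.Involutive.toPerm (fun τ => Function.update τ c (!τ c)) fun τ => by simp

theorem flipAt_apply (τ : (∀ i, S i) → Bool) (c : ∀ i, S i) :
    flipAt c τ = Function.update τ c (!τ c) := rfl

theorem flipAt_ne (τ : (∀ i, S i) → Bool) (c : ∀ i, S i) : τ c ≠ flipAt c τ c := by
  simp [flipAt_apply]

theorem eq_of_flipAt_ne {τ : (∀ i, S i) → Bool} {c d : ∀ i, S i} (h : τ d ≠ flipAt c τ d) :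
    d = c := by
  by_contra hd
  exact h (by rw [flipAt_apply, Function.update_of_ne hd])

/-- Guessing the sign at `c` tests `τ` against its flip. These distributions differ only on the
fibre over `c`, so their affinity is near 1; Bernoulli's inequality handles the power `2 * T`. -/
theorem one_sub_le_expect_wrongAt (τ : (∀ i, S i) → Bool) (c : ∀ i, S i) {T : ℕ}
    (A : Learner n T) :
    1 - 16 * T * H.γ ^ 2 * (H.support.filter fun s => H.cell s = c).card / H.support.card ≤
      2 * (H.expect τ (fun x => (H.output A x).real (H.wrongAt τ c)) +
        H.expect (flipAt c τ) fun x => (H.output A x).real (H.wrongAt (flipAt c τ) c)) := by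
  have h1 := H.affinity_pow_le_expect τ (flipAt c τ)
    (fun x => H.measureReal_mem_Icc A x (H.wrongAt τ c))
  simp only [H.wrongAt_of_ne (flipAt_ne τ c),
    probReal_compl_eq_one_sub (H.measurableSet_wrongAt τ c)]
  refine le_trans ?_ h1
  have h2 : 1 - 8 * H.γ ^ 2 * ((H.support.filter fun s => H.cell s = c).card : ℝ) /
      (H.support.card : ℝ) ≤ affinity (H.prob τ) (H.prob (flipAt c τ)) := by
    refine le_trans ?_ (H.le_affinity τ (flipAt c τ))
    have hsub : (H.support.filter fun s => τ (H.cell s) ≠ flipAt c τ (H.cell s)) ⊆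
        H.support.filter fun s => H.cell s = c :=
      Finset.monotone_filter_right _ fun s _ hs => eq_of_flipAt_ne hs
    have := Finset.card_le_card hsub
    gcongr
  have h3 := one_add_mul_le_pow
    (a := affinity (H.prob τ) (H.prob (flipAt c τ)) - 1)
    (by linarith [affinity_nonneg (H.prob τ) (H.prob (flipAt c τ))]) (2 * T)
  rw [add_sub_cancel] at h3
  refine le_trans ?_ h3
  push_cast
  have h4 := mul_le_mul_of_nonneg_left h2 (by positivity : (0 : ℝ) ≤ 2 * T)
  have h5 : 2 * (T : ℝ) * (1 - 8 * H.γ ^ 2 *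
      ((H.support.filter fun s => H.cell s = c).card : ℝ) / (H.support.card : ℝ)) =
      2 * T - 16 * T * H.γ ^ 2 *
        ((H.support.filter fun s => H.cell s = c).card : ℝ) / (H.support.card : ℝ) := by
    ring
  linarith

theorem sum_card_filter_cell :
    ∑ c ∈ H.cells, ((H.support.filter fun s => H.cell s = c).card : ℝ) = H.support.card := by
  exact_mod_cast (Finset.card_eq_sum_card_fiberwise fun s _ => H.cell_mem_cells s).symm

/-- The dependence on the number of signals, by averaging over the perturbations. -/
theorem card_cells_le_of_suffices {m : ℕ} (hm : ∀ i, Fintype.card (S i) = m) {ε δ : ℝ}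
    (hε : 0 < ε) (hγ : H.γ ^ 2 = 64 * ε) (hδ : δ < 1 / 100) {T : ℕ}
    (hT : Suffices (Set.univ : Set (JointDist S)) ε δ T) :
    (H.cells.card : ℝ) ≤ 2048 * ε * T := by
  obtain ⟨A, hA⟩ := hT
  set w : ((∀ i, S i) → Bool) → (∀ i, S i) → ℝ := fun τ c =>
    H.expect τ fun x => (H.output A x).real (H.wrongAt τ c) with hw
  have hR := H.card_cells_pos
  have hupper (τ : (∀ i, S i) → Bool) : ∑ c ∈ H.cells, w τ c ≤
      H.cells.card * (1 / 16 + 1 / 100) := by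
    have h1 := (hA _ (Set.mem_univ _)).trans (H.successProb_le hm hε hγ τ A)
    have h2 : ∑ c ∈ H.cells, w τ c = H.expect τ fun x =>
        ∑ c ∈ H.cells, (H.output A x).real (H.wrongAt τ c) := by
      simp only [hw, expect, Finset.mul_sum]
      rw [Finset.sum_comm]
    have h3 : (H.expect τ fun x =>
        (H.cells.card : ℝ) * (1 / 16 + 1 - (H.output A x).real (H.mostlyRight τ))) =
        H.cells.card * (1 / 16 + 1 - H.expect τ fun x =>
          (H.output A x).real (H.mostlyRight τ)) := by
      simp only [expect, mul_sub, Finset.sum_sub_distrib, ← Finset.sum_mul,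
        sum_prod_eq_one (H.sum_prob τ), one_mul, mul_left_comm _ (H.cells.card : ℝ),
        ← Finset.mul_sum]
    have h4 := H.expect_mono τ fun x => H.sum_measure_wrongAt_le τ (H.output A x)
    rw [h2]
    refine h4.trans (h3.trans_le ?_)
    exact mul_le_mul_of_nonneg_left (by linarith) hR.le
  -- Flipping at `c` permutes the sign patterns, so after summing over `τ` both error terms have the
  -- same total.
  have hlower (c : ∀ i, S i) : (Fintype.card ((∀ i, S i) → Bool) : ℝ) *
      (1 - 16 * T * H.γ ^ 2 * ((H.support.filter fun s => H.cell s = c).card : ℝ) /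
        (H.support.card : ℝ)) ≤ 4 * ∑ τ, w τ c := by
    have h1 := Finset.card_nsmul_le_sum Finset.univ _ _ fun τ _ =>
      H.one_sub_le_expect_wrongAt τ c A
    rw [← Finset.mul_sum, Finset.sum_add_distrib, nsmul_eq_mul, Finset.card_univ,
      Equiv.sum_comp (flipAt c)
        fun τ => H.expect τ fun x => (H.output A x).real (H.wrongAt τ c)] at h1
    linarith
  set N : ℝ := (Fintype.card ((∀ i, S i) → Bool) : ℝ) with hN
  have hN0 : 0 < N := Nat.cast_pos.2 Fintype.card_pos
  have h1 := Finset.sum_le_sum fun c (_ : c ∈ H.cells) => hlower c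
  rw [← Finset.mul_sum, ← Finset.mul_sum, Finset.sum_comm, Finset.sum_sub_distrib,
    ← Finset.sum_div, ← Finset.mul_sum, H.sum_card_filter_cell, Finset.sum_const,
    mul_div_cancel_right₀ _ H.card_support_pos.ne', nsmul_eq_mul, mul_one, hγ] at h1
  have h2 := Finset.sum_le_card_nsmul Finset.univ _ _ fun τ _ => hupper τ
  rw [nsmul_eq_mul, Finset.card_univ, ← hN] at h2
  -- The right side is `0.29 * N` times the number of cells, which leaves a positive fraction to
  -- compare with `ε * T`.
  have h3 : N * (H.cells.card - 16 * T * (64 * ε)) ≤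
      N * (4 * (H.cells.card * (1 / 16 + 1 / 100))) := by linarith
  have h4 := le_of_mul_le_mul_left h3 hN0
  linarith

end

/-- A hard family with perturbations of size `γ` exists as soon as every expert has at least two
signals. -/
theorem exists_hardFamily {n m : ℕ} {S : Fin n → Type u} [∀ i, Fintype (S i)] (hn : 2 ≤ n)
    (hm : 2 ≤ m) (hcard : ∀ i, Fintype.card (S i) = m) {γ : ℝ} (hγ0 : 0 ≤ γ)
    (hγ : γ ≤ 1 / 4) : ∃ H : HardFamily S, H.γ = γ := by
  have hab (i : Fin n) : ∃ a b : S i, a ≠ b :=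
    Fintype.exists_pair_of_one_lt_card (by rw [hcard]; omega)
  choose a b hab using hab
  have hm0 : (0 : ℝ) < m := by exact_mod_cast (by omega : 0 < m)
  have hn0 : (0 : ℝ) < n := by exact_mod_cast (by omega : 0 < n)
  -- Numbering the signals makes `φ i` injective; the denominator keeps the sum over `n` experts
  -- below `1 / 8`.
  let φ : ∀ i, S i → ℝ := fun i x => (Fintype.equivFin (S i) x : ℕ) / (8 * n * m)
  have hφ (i : Fin n) (x : S i) : φ i x ≤ 1 / (8 * n) := by
    have h1 : ((Fintype.equivFin (S i) x : ℕ) : ℝ) ≤ m := by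
      exact_mod_cast (Fintype.equivFin (S i) x).is_lt.le.trans_eq (hcard i)
    rw [div_le_div_iff₀ (by positivity) (by positivity)]
    nlinarith
  refine ⟨⟨⟨0, by omega⟩, ⟨1, by omega⟩, a, b, φ, γ, by simp, hab _, hab _, fun i x y h => ?_,
    fun i x => by positivity, fun s => ?_, hγ0, hγ⟩, rfl⟩
  · have h1 := (div_left_inj' (by positivity)).1 h
    exact (Fintype.equivFin (S i)).injective (Fin.ext (by exact_mod_cast h1))
  · refine (Finset.sum_le_card_nsmul _ _ _ fun i _ => hφ i (s i)).trans_eq ?_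
    rw [Finset.card_univ, Fintype.card_fin, nsmul_eq_mul]
    field_simp

end HardFamily

/-! ### From sample sizes to the sample complexity -/

theorem le_of_suffices {n m : ℕ} {S : Fin n → Type u} [∀ i, Fintype (S i)] (hn : 2 ≤ n)
    (hm : 2 ≤ m) (hcard : ∀ i, Fintype.card (S i) = m) {ε δ : ℝ} (hε0 : 0 < ε)
    (hε : ε < 1 / 1024) (hδ0 : 0 < δ) (hδ : δ < 1 / 100) {T : ℕ}
    (hT : Suffices (Set.univ : Set (JointDist S)) ε δ T) :
    1 / 8192 * (((m : ℝ) ^ (n - 2) + Real.log (1 / δ)) / ε) ≤ T := by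
  have hsq : √(64 * ε) ^ 2 = 64 * ε := Real.sq_sqrt (by positivity)
  -- The bound `ε < 1 / 1024` is what makes `√(64 * ε) ≤ 1 / 4`.
  obtain ⟨H, hH⟩ := HardFamily.exists_hardFamily hn hm hcard (Real.sqrt_nonneg (64 * ε))
    (Real.sqrt_le_iff.2 ⟨by norm_num, by linarith⟩)
  have hγ : H.γ ^ 2 = 64 * ε := by rw [hH, hsq]
  have h1 := H.card_cells_le_of_suffices hcard hε0 hγ hδ hT
  have h2 := H.log_le_of_suffices hcard hε0 hγ hδ0 hδ hT
  rw [H.card_cells hcard] at h1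
  push_cast at h1
  rw [← mul_div_assoc, div_le_iff₀ hε0]
  nlinarith

theorem le_sampleComplexity {n : ℕ} {S : Fin n → Type u} [∀ i, Fintype (S i)]
    {F : Set (JointDist S)} {ε δ B : ℝ} (hB : ∀ T, Suffices F ε δ T → B ≤ T) :
    ENNReal.ofReal B ≤ ((sampleComplexity F ε δ : ℕ∞) : ℝ≥0∞) := by
  rw [sampleComplexity]
  obtain h | h := Set.eq_empty_or_nonempty {T₀ : ℕ | ∀ T : ℕ, T₀ ≤ T → Suffices F ε δ T}
  · simp [h]
  · obtain ⟨T₀, hT₀, hs⟩ := csInf_mem (h.image fun T₀ : ℕ => (T₀ : ℕ∞))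
    rw [← hs]
    simpa using ENNReal.ofReal_le_ofReal (hB T₀ (hT₀ T₀ le_rfl))

end ForecastAggregation

theorem theorem4p1 :
    ∃ C c ε₀ : ℝ, 0 < C ∧ 0 < c ∧ 0 < ε₀ ∧
      ∀ (n m : ℕ) (S : Fin n → Type u) [∀ i, Fintype (S i)],
        2 ≤ n → 1 ≤ m → (∀ i, Fintype.card (S i) = m) →
        ∀ ε δ : ℝ, 0 < ε → ε < 1 → 0 < δ → δ < 1 →
          ((ForecastAggregation.sampleComplexity
              (Set.univ : Set (ForecastAggregation.JointDist S)) ε δ : ℕ∞) : ℝ≥0∞) ≤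
            ENNReal.ofReal (C * (((m : ℝ) ^ n + Real.log (1 / δ)) / ε ^ 2)) ∧
          (2 ≤ m → ε < ε₀ → δ < 1 / 100 →
            ENNReal.ofReal (c * (((m : ℝ) ^ (n - 2) + Real.log (1 / δ)) / ε)) ≤
              ((ForecastAggregation.sampleComplexity
                (Set.univ : Set (ForecastAggregation.JointDist S)) ε δ : ℕ∞) : ℝ≥0∞)) := by
  refine ⟨33, 1 / 8192, 1 / 1024, by norm_num, by norm_num, by norm_num, ?_⟩
  intro n m S _ hn hm hcard ε δ hε0 hε1 hδ0 hδ1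
  refine ⟨ForecastAggregation.sampleComplexity_le _ hm hcard hε0 hε1 hδ0 hδ1,
    fun hm2 hε hδ => ForecastAggregation.le_sampleComplexity fun T hT => ?_⟩
  exact ForecastAggregation.le_of_suffices hn hm2 hcard hε0 hε hδ0 hδ hT
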